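/- For $k,n\ge 1$ let $\mathcal F_{n,k}$ be the set of fillings of the rectangle with $k$ rows and $n$ columns by the integers $1,\dots,kn$, each used once, in which every column increases from bottom to top. For a filling $G$ with distinct positive integer entries, let $\mathrm{red}(G)$ be obtained by replacing the $i$-th smallest entry by $i$. For $P\in\mathcal F_{2,k}$, a $P$-match in $F\in\mathcal F_{n,k}$ starting at position $i$ (where $1\le i\le n-1$) means that the filling formed by columns $i,i+1$ of $F$ has reduction $P$. Let $full_n^P$ be the number of $F\in\mathcal F_{n,k}$ with exactly $n-1$ $P$-matches, i.e. with a $P$-match at each of the positions $1,\dots,n-1$ (so $full_1^P=1$). Theorem. (1) If $P=\begin{array}{|c|c|}\hline 3&4\\ \hline 1&2\\ \hline\end{array}$, then for all $n\ge 1$, $full_n^{P}=C_{n-1}$, where $C_m=\frac1{m+1}\binom{2m}{m}$ is the $m$-th Catalan number. (2) If $Q=\begin{array}{|c|c|}\hline 5&6\\ \hline 2&4\\ \hline 1&3\\ \hline\end{array}$, then for all $n\ge 0$, $full_{n+1}^{Q}=\frac{1}{2n+1}\binom{3n}{n}$; equivalently, for all $n\ge1$, $full_n^{Q}=\frac1{2n-1}\binom{3n-3}{n-1}$.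 -/

import Mathlib

namespace RectFilling

/-- A filling of the rectangle with `k` rows and `n` columns by natural numbers.
`F i j` is the entry in row `i` and column `j`; rows are counted from bottom to top and columns from
left to right, both starting at `0`. -/
abbrev Filling (k n : ℕ) := Fin k → Fin n → ℕ

/-- `F` is an element of `𝓕_{n,k}`: each of the integers `1, …, kn` is used exactly once, and the
entries of each column increase from bottom to top. -/
def IsColumnStrict {k n : ℕ} (F : Filling k n) : Prop :=
  Set.BijOn (fun c : Fin k × Fin n => F c.1 c.2) Set.univ (Set.Icc 1 (k * n)) ∧
    ∀ j : Fin n, StrictMono (fun i : Fin k => F i j)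

/-- The reduction of a filling with distinct entries: the `m`-th smallest entry is replaced by `m`,
that is, each entry is replaced by the number of cells whose entry does not exceed it. -/
def red {k n : ℕ} (F : Filling k n) : Filling k n :=
  fun i j => (Finset.univ.filter (fun c : Fin k × Fin n => F c.1 c.2 ≤ F i j)).card

/-- The filling formed by the columns `s, s + 1, …, s + j - 1` of `F`. -/
def window {k n : ℕ} (F : Filling k n) (s j : ℕ) (h : s + j ≤ n) : Filling k j :=
  fun i a => F i ⟨s + a.1, by have := a.2; omega⟩

/-- There is a `P`-match in `F` starting at column `s`. -/
def MatchAt {k j n : ℕ} (P : Filling k j) (F : Filling k n) (s : ℕ) : Prop :=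
  ∃ h : s + j ≤ n, red (window F s j h) = P

/-- The number of `P`-matches in `F`. -/
noncomputable def pmch {k j n : ℕ} (P : Filling k j) (F : Filling k n) : ℕ :=
  Set.ncard {s : ℕ | MatchAt P F s}

/-- The set of `F ∈ 𝓕_{n,k}` that have exactly `n - 1` matches of the two-column pattern `P`. -/
def Full {k : ℕ} (P : Filling k 2) (n : ℕ) : Set (Filling k n) :=
  {F | IsColumnStrict F ∧ pmch P F + 1 = n}

/-- The number of elements of `Full P n`. -/
noncomputable def full {k : ℕ} (P : Filling k 2) (n : ℕ) : ℕ :=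
  (Full P n).ncard

/-- The tableau with bottom row `1 2` and top row `3 4`. -/
def tableau22 : Filling 2 2 := ![![1, 2], ![3, 4]]

/-- The tableau with rows `1 3`, `2 4`, `5 6` from bottom to top. -/
def tableau222 : Filling 3 2 := ![![1, 3], ![2, 4], ![5, 6]]

end RectFilling

namespace RectFilling

open Finset

/-! Both patterns are cases, m = 1 and m = 2, of `stackedTableau m`. Matches at all positions mean
that the lower m rows, read column by column, form an increasing word d, that the top row c
increases, and that c j exceeds the lower entries of every column up to j + 1, i.e. the first m(j +
2) letters of d (`stackedAt_iff_isShuffle`). Exactly c j - 1 entries are below c j, and j of them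
lie in c, so the last condition is a lower bound on c j; for the last column it forces the maximal
entry (`forall_lt_iff_le_apply`). The filling is thus determined by the set of its other n top
entries, which can be any ballot set (`full_stackedTableau`).

Ballot sets obey a Pascal-type recurrence with a vanishing boundary, solved by a binomial
coefficient minus m times its neighbour (`card_ballotSets_add`); this difference is the Fuss–Catalan
number of `card_ballotSets`. -/

/-! ### Counting ballot sets -/

/-- The `b`-element sets of natural numbers below `L` whose `i`-th smallest element `x`, counting
from `0`, satisfies `(m + 1) * (i + 2) ≤ x + 1`. -/
def ballotSets (m L b : ℕ) : Finset (Finset ℕ) :=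
  ((range L).powersetCard b).filter
    fun T => ∀ x ∈ T, (m + 1) * ((T.filter (· < x)).card + 2) ≤ x + 1

lemma mem_ballotSets {m L b : ℕ} {T : Finset ℕ} :
    T ∈ ballotSets m L b ↔ (T ⊆ range L ∧ T.card = b) ∧
      ∀ x ∈ T, (m + 1) * ((T.filter (· < x)).card + 2) ≤ x + 1 := by
  simp [ballotSets]

lemma card_ballotSets_zero (m L : ℕ) : (ballotSets m L 0).card = 1 := by
  simp [ballotSets, filter_singleton]

lemma insert_mem_ballotSets {m L b : ℕ} {T : Finset ℕ} (hT : T ⊆ range L) :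
    insert L T ∈ ballotSets m (L + 1) (b + 1) ↔
      T ∈ ballotSets m L b ∧ (m + 1) * (b + 2) ≤ L + 1 := by
  have hL : L ∉ T := fun h => by simpa using hT h
  have hlt : ∀ x ∈ T, x < L := fun x hx => by simpa using hT hx
  have h1 : (insert L T).filter (· < L) = T := by
    rw [filter_insert, if_neg (lt_irrefl _), filter_true_of_mem hlt]
  have h2 : ∀ x ∈ T, (insert L T).filter (· < x) = T.filter (· < x) := fun x hx => by
    rw [filter_insert, if_neg (hlt x hx).le.not_gt]
  have h3 : insert L T ⊆ range (L + 1) := by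
    rw [range_add_one]; exact insert_subset_insert _ hT
  simp only [mem_ballotSets, h3, hT, card_insert_of_notMem hL, true_and, forall_mem_insert, h1,
    add_left_inj]
  constructor
  · rintro ⟨hc, h, h'⟩
    refine ⟨⟨hc, fun x hx => ?_⟩, hc ▸ h⟩
    have := h' x hx
    rwa [h2 x hx] at this
  · rintro ⟨⟨hc, h⟩, h'⟩
    refine ⟨hc, hc.symm ▸ h', fun x hx => ?_⟩
    rw [h2 x hx]
    exact h x hx

/-- Split by whether L belongs to the set. If it does, it is the largest element, so its rank is b
and the conditions on the other elements do not change. -/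
lemma card_ballotSets_succ (m L b : ℕ) :
    (ballotSets m (L + 1) (b + 1)).card = (ballotSets m L (b + 1)).card +
      if (m + 1) * (b + 2) ≤ L + 1 then (ballotSets m L b).card else 0 := by
  have key : ballotSets m (L + 1) (b + 1) = ballotSets m L (b + 1) ∪
      if (m + 1) * (b + 2) ≤ L + 1 then (ballotSets m L b).image (insert L) else ∅ := by
    ext T
    by_cases hL : L ∈ T
    · have h0 : T ∉ ballotSets m L (b + 1) := fun h => by
        simpa using (mem_ballotSets.1 h).1.1 hL
      constructor
      · intro h
        have hs : T.erase L ⊆ range L := fun x hx => by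
          have := (mem_ballotSets.1 h).1.1 (mem_of_mem_erase hx)
          have := ne_of_mem_erase hx
          simp at *
          omega
        rw [← insert_erase hL, insert_mem_ballotSets hs] at h
        rw [if_pos h.2]
        exact mem_union_right _ (mem_image.2 ⟨_, h.1, insert_erase hL⟩)
      · intro h
        rcases mem_union.1 h with h | h
        · exact absurd h h0
        split_ifs at h with hc
        · obtain ⟨S, hS, rfl⟩ := mem_image.1 h
          exact (insert_mem_ballotSets (mem_ballotSets.1 hS).1.1).2 ⟨hS, hc⟩
        · simp at h
    · have h0 : T ∉ (if (m + 1) * (b + 2) ≤ L + 1 then (ballotSets m L b).image (insert L)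
          else ∅) := by
        intro h
        split_ifs at h
        · obtain ⟨S, -, rfl⟩ := mem_image.1 h
          exact hL (mem_insert_self _ _)
        · simp at h
      have h1 : T ⊆ range (L + 1) ↔ T ⊆ range L := by
        rw [range_add_one, subset_insert_iff_of_notMem hL]
      simp only [mem_union, h0, or_false, mem_ballotSets, h1]
  rw [key, card_union_of_disjoint]
  · congr 1
    split_ifs
    · refine card_image_of_injOn fun S hS T hT h => ?_
      have hS' : L ∉ S := fun h => by simpa using (mem_ballotSets.1 hS).1.1 h
      have hT' : L ∉ T := fun h => by simpa using (mem_ballotSets.1 hT).1.1 h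
      rw [← erase_insert hS', ← erase_insert hT']
      exact congrArg (erase · L) h
    · rfl
  · rw [disjoint_left]
    intro T hT h
    have hT' : L ∉ T := fun h => by simpa using (mem_ballotSets.1 hT).1.1 h
    split_ifs at h
    · obtain ⟨S, -, rfl⟩ := mem_image.1 h
      exact hT' (mem_insert_self _ _)
    · simp at h

lemma card_ballotSets_eq_zero {m L b : ℕ} (h : L < (m + 1) * (b + 2)) :
    (ballotSets m L (b + 1)).card = 0 := by
  induction L with
  | zero => simp [ballotSets]
  | succ L ih => rw [card_ballotSets_succ, ih (by omega), if_neg (by omega)]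

/-- The ballot formula, written additively to avoid subtraction. The recurrence matches Pascal's
rule for both binomials. The hypothesis on a starts at the boundary a + 1 = m(b + 1), where the set
size is too large by one step and the count is zero. -/
lemma card_ballotSets_add (m b : ℕ) : ∀ a : ℕ, m * (b + 1) ≤ a + 1 →
    (ballotSets m (a + b + m + 2) (b + 1)).card + m * (a + b + 1).choose b =
      (a + b + 1).choose (b + 1) := by
  induction b with
  | zero =>
    intro a
    induction a with
    | zero =>
      intro h
      rw [card_ballotSets_succ, card_ballotSets_zero, card_ballotSets_eq_zero (by omega)]
      have hm : m ≤ 1 := by omega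
      interval_cases m <;> simp
    | succ a ih =>
      intro h
      rcases Nat.lt_or_ge (a + 1) (m * 1) with h' | h'
      · obtain rfl : m = a + 2 := by omega
        rw [card_ballotSets_eq_zero (by omega)]
        simp
      · have := ih h'
        rw [show a + 1 + 0 + m + 2 = (a + 0 + m + 2) + 1 by ring, card_ballotSets_succ,
          card_ballotSets_zero, if_pos (by omega)]
        simp at *
        omega
  | succ b ihb =>
    -- On the boundary there are no sets, and the two binomial terms agree by absorption.
    have base : ∀ a : ℕ, a + 1 = m * (b + 2) →
        (ballotSets m (a + (b + 1) + m + 2) (b + 1 + 1)).card +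
          m * (a + (b + 1) + 1).choose (b + 1) = (a + (b + 1) + 1).choose (b + 1 + 1) := by
      intro a ha
      rw [card_ballotSets_eq_zero (by nlinarith), zero_add]
      have := Nat.choose_succ_right_eq (a + (b + 1) + 1) (b + 1)
      rw [show a + (b + 1) + 1 - (b + 1) = m * (b + 2) by omega] at this
      refine Nat.eq_of_mul_eq_mul_right (Nat.succ_pos (b + 1)) ?_
      rw [this]
      simp only [Nat.succ_eq_add_one]
      ring
    intro a
    induction a with
    | zero =>
      intro h
      rcases Nat.lt_or_ge 0 m with hm | hm
      · nlinarith
      -- For m = 0 no natural a lies on the boundary, so the recurrence is unfolded once instead;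
      -- its first term vanishes.
      · obtain rfl : m = 0 := by omega
        have := ihb 0 (by omega)
        rw [show 0 + (b + 1) + 0 + 2 = (0 + b + 0 + 2) + 1 by ring, card_ballotSets_succ,
          card_ballotSets_eq_zero (by omega), if_pos (by omega)]
        simp at *
        omega
    | succ a ih =>
      intro h
      rcases Nat.lt_or_ge (a + 1) (m * (b + 1 + 1)) with h' | h'
      · exact base (a + 1) (by rw [show b + 2 = b + 1 + 1 by ring]; omega)
      · have h1 := ih h'
        have h2 := ihb (a + 1) (by nlinarith)
        rw [show a + 1 + (b + 1) + m + 2 = (a + (b + 1) + m + 2) + 1 by ring,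
          card_ballotSets_succ, if_pos (by nlinarith),
          show a + 1 + (b + 1) + 1 = (a + (b + 1) + 1) + 1 by ring,
          Nat.choose_succ_succ _ (b + 1), Nat.choose_succ_succ _ b, ← h1]
        rw [show a + 1 + b + m + 2 = a + (b + 1) + m + 2 by ring,
          show a + 1 + b + 1 = a + (b + 1) + 1 by ring] at h2
        linarith

theorem card_ballotSets (m n : ℕ) :
    ((ballotSets m ((m + 1) * (n + 1)) n).card : ℚ) =
      1 / ((m : ℚ) * n + 1) * (((m + 1) * n).choose n : ℚ) := by
  cases n with
  | zero => simp [card_ballotSets_zero]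
  | succ b =>
    have h := card_ballotSets_add m b (m * (b + 1)) (by omega)
    rw [show m * (b + 1) + b + m + 2 = (m + 1) * (b + 1 + 1) by ring,
      show m * (b + 1) + b + 1 = (m + 1) * (b + 1) by ring] at h
    -- Absorption expresses the subtracted binomial through the other one, leaving a single term.
    have h2 := Nat.choose_succ_right_eq ((m + 1) * (b + 1)) b
    rw [show (m + 1) * (b + 1) - b = m * (b + 1) + 1 by
      rw [add_mul, one_mul]; omega] at h2
    have h' := congrArg (Nat.cast : ℕ → ℚ) h
    have h2' := congrArg (Nat.cast : ℕ → ℚ) h2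
    push_cast at h' h2' ⊢
    have h0 : (m : ℚ) * (b + 1) + 1 ≠ 0 := by positivity
    rw [one_div, inv_mul_eq_div, eq_div_iff h0]
    linear_combination (↑m * (↑b + 1) + 1) * h' + m * h2'

/-! ### Shuffles and the sets that encode them -/

lemma apply_lt_iff_lt_card {k : ℕ} {f : Fin k → ℕ} (hf : StrictMono f) (i : Fin k) (x : ℕ) :
    f i < x ↔ (i : ℕ) < (univ.filter fun j => f j < x).card := by
  constructor
  · intro h
    have : Iic i ⊆ univ.filter fun j => f j < x := fun j hj => by
      simpa using (hf.monotone (mem_Iic.1 hj)).trans_lt h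
    simpa [Nat.succ_le_iff] using card_le_card this
  · intro h
    by_contra! hx
    have : (univ.filter fun j => f j < x) ⊆ Iio i := fun j hj => by
      simpa using hf.lt_iff_lt.1 ((mem_filter.1 hj).2.trans_le hx)
    have := card_le_card this
    rw [Fin.card_Iio] at this
    omega

lemma card_filter_apply_lt_apply {k : ℕ} {f : Fin k → ℕ} (hf : StrictMono f) (i : Fin k) :
    (univ.filter fun j => f j < f i).card = i := by
  simp only [hf.lt_iff_lt]
  rw [← Fin.card_Iio i]
  congr 1
  ext j
  simp

lemma card_filter_image {k : ℕ} {f : Fin k → ℕ} (hf : StrictMono f) (x : ℕ) :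
    ((univ.image f).filter (· < x)).card = (univ.filter fun j => f j < x).card := by
  rw [filter_image, card_image_of_injective _ hf.injective]

/-- The increasing sequences `c` and `d` partition `{1, …, (m + 1) * (n + 1)}`, and each `c j` exceeds
the first `m * (j + 2)` terms of `d`. -/
structure IsShuffle (m n : ℕ) (c : Fin (n + 1) → ℕ) (d : Fin ((n + 1) * m) → ℕ) : Prop where
  bijOn : Set.BijOn (Sum.elim c d) Set.univ (Set.Icc 1 ((m + 1) * (n + 1)))
  left : StrictMono c
  right : StrictMono d
  lt : ∀ (j : Fin (n + 1)) (p : Fin ((n + 1) * m)), (p : ℕ) < m * (j + 2) → d p < c j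

lemma card_filter_lt_add {a b L : ℕ} {c : Fin a → ℕ} {d : Fin b → ℕ}
    (h : Set.BijOn (Sum.elim c d) Set.univ (Set.Icc 1 L)) {x : ℕ} (hx : x ≤ L) :
    (univ.filter fun j => c j < x).card + (univ.filter fun p => d p < x).card = x - 1 := by
  have h1 : (univ.filter fun s => Sum.elim c d s < x).card = x - 1 := by
    rw [← card_image_of_injective _ (Set.injOn_univ.1 h.injOn)]
    have : (univ.filter fun s => Sum.elim c d s < x).image (Sum.elim c d) = Ico 1 x := by
      ext y
      simp only [mem_image, mem_filter, mem_univ, true_and, mem_Ico]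
      constructor
      · rintro ⟨s, hs, rfl⟩
        exact ⟨(h.mapsTo (Set.mem_univ s)).1, hs⟩
      · rintro ⟨h1, h2⟩
        obtain ⟨s, -, hs⟩ := h.surjOn (show y ∈ Set.Icc 1 L from ⟨h1, by omega⟩)
        exact ⟨s, hs ▸ h2, hs⟩
    rw [this, Nat.card_Ico]
  rw [← h1]
  simp only [card_filter, Fintype.sum_sum_type, Sum.elim_inl, Sum.elim_inr]
  rfl

/-- Since c and d partition an initial segment, c j exceeds exactly c j - 1 - j letters of d, and
these are its first ones. -/
lemma forall_lt_iff_le_apply {m n : ℕ} {c : Fin (n + 1) → ℕ} {d : Fin ((n + 1) * m) → ℕ}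
    (h : Set.BijOn (Sum.elim c d) Set.univ (Set.Icc 1 ((m + 1) * (n + 1))))
    (hc : StrictMono c) (hd : StrictMono d) :
    (∀ (j : Fin (n + 1)) (p : Fin ((n + 1) * m)), (p : ℕ) < m * (j + 2) → d p < c j) ↔
      c (Fin.last n) = (m + 1) * (n + 1) ∧
        ∀ j : Fin n, (m + 1) * (j + 2) ≤ c j.castSucc + 1 := by
  have hmem : ∀ j, 1 ≤ c j ∧ c j ≤ (m + 1) * (n + 1) := fun j =>
    h.mapsTo (Set.mem_univ (Sum.inl j))
  have hcount : ∀ j : Fin (n + 1),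
      (j : ℕ) + (univ.filter fun p => d p < c j).card = c j - 1 := fun j => by
    rw [← card_filter_lt_add h (hmem j).2, card_filter_apply_lt_apply hc]
  have key : ∀ j : Fin (n + 1),
      (∀ p : Fin ((n + 1) * m), (p : ℕ) < m * (j + 2) → d p < c j) ↔
        min (m * (j + 2)) ((n + 1) * m) + j + 1 ≤ c j := fun j => by
    have h1 := hcount j
    have h2 := hmem j
    constructor
    · intro H
      by_contra! hlt
      have := (apply_lt_iff_lt_card hd _ _).1
        (H ⟨min (m * (j + 2)) ((n + 1) * m) - 1, by omega⟩ (by simp only; omega))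
      simp only at this
      omega
    · intro H p hp
      rw [apply_lt_iff_lt_card hd]
      have := p.2
      omega
  simp only [key]
  rw [Fin.forall_fin_succ', and_comm]
  refine and_congr ?_ (forall_congr' fun j => ?_)
  -- At the last index m(n + 2) is truncated to the length of d, so the lower bound equals the
  -- largest available value.
  · have := (hmem (Fin.last n)).2
    have e : (m + 1) * (n + 1) = (n + 1) * m + n + 1 := by ring
    have : (n + 1) * m ≤ m * (n + 2) := by nlinarith
    rw [Fin.val_last, min_eq_right this]
    omega
  · have : m * (j + 2) ≤ (n + 1) * m := by
      rw [mul_comm]; exact Nat.mul_le_mul_right _ (by have := j.2; omega)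
    have e : (m + 1) * ((j : ℕ) + 2) = m * (j + 2) + j + 1 + 1 := by ring
    rw [Fin.val_castSucc, min_eq_left this]
    omega

lemma IsShuffle.apply_last {m n : ℕ} {c : Fin (n + 1) → ℕ} {d : Fin ((n + 1) * m) → ℕ}
    (h : IsShuffle m n c d) : c (Fin.last n) = (m + 1) * (n + 1) :=
  ((forall_lt_iff_le_apply h.bijOn h.left h.right).1 h.lt).1

lemma IsShuffle.image_mem_ballotSets {m n : ℕ} {c : Fin (n + 1) → ℕ} {d : Fin ((n + 1) * m) → ℕ}
    (h : IsShuffle m n c d) :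
    (univ.image fun j : Fin n => c j.castSucc) ∈ ballotSets m ((m + 1) * (n + 1)) n := by
  obtain ⟨h1, h2⟩ := (forall_lt_iff_le_apply h.bijOn h.left h.right).1 h.lt
  have hmono : StrictMono fun j : Fin n => c j.castSucc := h.left.comp Fin.strictMono_castSucc
  refine mem_ballotSets.2 ⟨⟨?_, ?_⟩, ?_⟩
  · intro x hx
    obtain ⟨j, -, rfl⟩ := mem_image.1 hx
    rw [mem_range, ← h1]
    exact h.left (Fin.castSucc_lt_last j)
  · rw [card_image_of_injective _ hmono.injective, card_univ, Fintype.card_fin]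
  · intro x hx
    obtain ⟨j, -, rfl⟩ := mem_image.1 hx
    rw [card_filter_image hmono, card_filter_apply_lt_apply hmono]
    exact h2 j

lemma IsShuffle.range_right {m n : ℕ} {c : Fin (n + 1) → ℕ} {d : Fin ((n + 1) * m) → ℕ}
    (h : IsShuffle m n c d) :
    Set.range d = Set.Icc 1 ((m + 1) * (n + 1)) \ Set.range c := by
  have hi := Set.injOn_univ.1 h.bijOn.injOn
  have hr := h.bijOn.image_eq
  rw [Set.image_univ, Set.Sum.elim_range] at hr
  rw [← hr, Set.union_sdiff_left, sdiff_eq_left.2]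
  rw [Set.disjoint_left]
  rintro _ ⟨p, rfl⟩ ⟨j, hj⟩
  exact Sum.inl_ne_inr (hi (show Sum.elim c d (Sum.inl j) = Sum.elim c d (Sum.inr p) from hj))

lemma IsShuffle.ext {m n : ℕ} {c c' : Fin (n + 1) → ℕ} {d d' : Fin ((n + 1) * m) → ℕ}
    (h : IsShuffle m n c d) (h' : IsShuffle m n c' d')
    (hi : (univ.image fun j : Fin n => c j.castSucc) = univ.image fun j : Fin n => c' j.castSucc) :
    c = c' ∧ d = d' := by
  have hc : c = c' := by
    have h1 : StrictMono fun j : Fin n => c j.castSucc := h.left.comp Fin.strictMono_castSucc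
    have h2 : StrictMono fun j : Fin n => c' j.castSucc := h'.left.comp Fin.strictMono_castSucc
    have hr := congrArg (fun s : Finset ℕ => (s : Set ℕ)) hi
    simp only [coe_image, coe_univ, Set.image_univ] at hr
    have := (h1.range_inj h2).1 hr
    funext j
    induction j using Fin.lastCases with
    | last => rw [h.apply_last, h'.apply_last]
    | cast j => exact congrFun this j
  subst hc
  exact ⟨rfl, (h.right.range_inj h'.right).1 (by rw [h.range_right, h'.range_right])⟩

lemma exists_isShuffle {m n : ℕ} {T : Finset ℕ} (hT : T ∈ ballotSets m ((m + 1) * (n + 1)) n) :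
    ∃ c d, IsShuffle m n c d ∧ (univ.image fun j : Fin n => c j.castSucc) = T := by
  obtain ⟨⟨hsub, hcard⟩, hbal⟩ := mem_ballotSets.1 hT
  set L := (m + 1) * (n + 1) with hL
  let c : Fin (n + 1) → ℕ := Fin.snoc (α := fun _ => ℕ) (T.orderEmbOfFin hcard) L
  have hcs : ∀ j : Fin n, c j.castSucc = T.orderEmbOfFin hcard j := fun j => by simp [c]
  have hcl : c (Fin.last n) = L := by simp [c]
  have himg : (univ.image fun j : Fin n => c j.castSucc) = T := by
    simp only [hcs]
    exact image_orderEmbOfFin_univ T hcard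
  have hcT : ∀ j : Fin n, c j.castSucc ∈ T := fun j => hcs j ▸ orderEmbOfFin_mem T hcard j
  have hm' : StrictMono fun j : Fin n => c j.castSucc := by
    simp only [hcs]
    exact (T.orderEmbOfFin hcard).strictMono
  have hmono : StrictMono c := by
    intro i j hij
    induction j using Fin.lastCases with
    | last =>
      induction i using Fin.lastCases with
      | last => exact absurd hij (lt_irrefl _)
      | cast i => rw [hcl]; exact mem_range.1 (hsub (hcT i))
    | cast j =>
      induction i using Fin.lastCases with
      | last => exact absurd hij (Fin.castSucc_lt_last j).not_gt
      | cast i => exact hm' (by simpa using hij)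
  have hle : ∀ j : Fin n, (m + 1) * (j + 2) ≤ c j.castSucc + 1 := fun j => by
    have := hbal _ (hcT j)
    rwa [← himg, card_filter_image hm', card_filter_apply_lt_apply hm'] at this
  have hcI : univ.image c ⊆ Icc 1 L := by
    intro x hx
    obtain ⟨j, -, rfl⟩ := mem_image.1 hx
    induction j using Fin.lastCases with
    | last => rw [hcl]; simp [hL, Nat.succ_le_iff]
    | cast j =>
      have h1 := mem_range.1 (hsub (hcT j))
      have h2 := hle j
      rw [mem_Icc]
      constructor
      · nlinarith
      · exact h1.le
  have hDc : (Icc 1 L \ univ.image c).card = (n + 1) * m := by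
    rw [card_sdiff_of_subset hcI, Nat.card_Icc, card_image_of_injective _ hmono.injective,
      card_univ, Fintype.card_fin, hL, add_mul, mul_comm m, one_mul]
    omega
  let d : Fin ((n + 1) * m) → ℕ := (Icc 1 L \ univ.image c).orderEmbOfFin hDc
  have hd : StrictMono d := ((Icc 1 L \ univ.image c).orderEmbOfFin hDc).strictMono
  have hdr : Set.range d = ((Icc 1 L \ univ.image c : Finset ℕ) : Set ℕ) :=
    range_orderEmbOfFin _ hDc
  have hdm : ∀ p, d p ∈ Icc 1 L \ univ.image c := fun p => orderEmbOfFin_mem _ hDc p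
  have hbij : Set.BijOn (Sum.elim c d) Set.univ (Set.Icc 1 L) := by
    have hr : Set.Icc 1 L = Set.range (Sum.elim c d) := by
      rw [Set.Sum.elim_range, hdr, coe_sdiff, coe_image, coe_univ, Set.image_univ,
        Set.union_sdiff_self, coe_Icc, Set.union_eq_self_of_subset_left]
      rintro _ ⟨j, rfl⟩
      exact mem_Icc.1 (hcI (mem_image_of_mem c (mem_univ j)))
    rw [hr, ← Set.image_univ]
    refine Set.InjOn.bijOn_image (Set.injOn_univ.2 ?_)
    refine Function.Injective.sumElim hmono.injective hd.injective fun j p h => ?_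
    exact (mem_sdiff.1 (hdm p)).2 (h ▸ mem_image_of_mem c (mem_univ j))
  exact ⟨c, d, ⟨hbij, hmono, hd, (forall_lt_iff_le_apply hbij hmono hd).2 ⟨hcl, hle⟩⟩, himg⟩

/-! ### Reduction and matches of the stacked pattern -/

lemma red_lt_red_iff {k n : ℕ} (F : Filling k n) (i i' : Fin k) (j j' : Fin n) :
    red F i j < red F i' j' ↔ F i j < F i' j' := by
  constructor
  · intro h
    by_contra! hle
    exact h.not_ge (card_le_card (monotone_filter_right _ fun c _ hc => le_trans hc hle))
  · intro h
    refine card_lt_card (ssubset_iff_of_subset (monotone_filter_right _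
      fun c _ hc => le_trans hc h.le) |>.2 ⟨(i', j'), by simp, by simpa using h⟩)

lemma red_eq_iff {k n : ℕ} {F P : Filling k n} (hP : red P = P) :
    red F = P ↔ ∀ i i' j j', F i j < F i' j' ↔ P i j < P i' j' := by
  constructor
  · rintro rfl i i' j j'
    exact (red_lt_red_iff F i i' j j').symm
  · intro h
    rw [← hP]
    funext i j
    unfold red
    congr 1
    ext c
    simp only [mem_filter, mem_univ, true_and]
    rw [← not_lt, h, not_lt]

/-- The two-column tableau whose lower `m` rows, read column by column, are `1, …, 2 * m` and whose
top row is `2 * m + 1, 2 * m + 2`. -/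
def stackedTableau (m : ℕ) : Filling (m + 1) 2 :=
  Fin.snoc (α := fun _ => Fin 2 → ℕ) (fun i j => m * j + i + 1) (fun j => 2 * m + j + 1)

lemma stackedTableau_castSucc (m : ℕ) (i : Fin m) (j : Fin 2) :
    stackedTableau m i.castSucc j = m * j + i + 1 := by
  simp [stackedTableau]

lemma stackedTableau_last (m : ℕ) (j : Fin 2) :
    stackedTableau m (Fin.last m) j = 2 * m + j + 1 := by
  simp [stackedTableau]

/-- The order relations between two consecutive columns that a match of `stackedTableau` imposes. -/
def StackedAt {m n : ℕ} (F : Filling (m + 1) (n + 1)) (s : Fin n) : Prop :=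
  F (Fin.last m) s.castSucc < F (Fin.last m) s.succ ∧
    (∀ i i' : Fin m, F i.castSucc s.castSucc < F i'.castSucc s.succ) ∧
    ∀ i : Fin m, F i.castSucc s.succ < F (Fin.last m) s.castSucc

/-- Together with increasing columns, the relations of `StackedAt` compare every pair of cells, so
they fix the whole relative order. -/
lemma red_eq_stackedTableau_iff {m : ℕ} (hm : red (stackedTableau m) = stackedTableau m)
    {G : Filling (m + 1) 2} (hG : ∀ j, StrictMono fun i => G i j) :
    red G = stackedTableau m ↔ StackedAt G 0 := by
  rw [red_eq_iff hm]
  constructor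
  · intro h
    simp only [StackedAt, h, stackedTableau_castSucc, stackedTableau_last]
    simp
    constructor
    · intros; omega
    · intros; omega
  · rintro ⟨h1, h2, h3⟩
    simp only [Fin.castSucc_zero, Fin.succ_zero_eq_one] at h1 h2 h3
    have hlow : ∀ (i : Fin m) (j j' : Fin 2), G i.castSucc j < G (Fin.last m) j' := by
      intro i j j'
      have e0 := hG 0 (Fin.castSucc_lt_last i)
      have e1 := h3 i
      have e2 := h2 i i
      simp only at e0
      fin_cases j <;> fin_cases j' <;> simp <;> omega
    have key : ∀ i i' j j', stackedTableau m i j < stackedTableau m i' j' → G i j < G i' j' := by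
      intro i i' j j' h
      induction i using Fin.lastCases with
      | last =>
        induction i' using Fin.lastCases with
        | last =>
          rw [stackedTableau_last, stackedTableau_last] at h
          fin_cases j <;> fin_cases j' <;> simp_all
        | cast i' =>
          rw [stackedTableau_last, stackedTableau_castSucc] at h
          have := i'.2
          fin_cases j <;> fin_cases j' <;> simp at h <;> omega
      | cast i =>
        induction i' using Fin.lastCases with
        | last => exact hlow i j j'
        | cast i' =>
          rw [stackedTableau_castSucc, stackedTableau_castSucc] at h
          have := i.2
          have := i'.2
          have hmono : ∀ j, (i : ℕ) < i' → G i.castSucc j < G i'.castSucc j := fun j hi =>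
            hG j (show i.castSucc < i'.castSucc from hi)
          fin_cases j <;> fin_cases j' <;> simp at h
          · exact hmono 0 h
          · exact h2 i i'
          · omega
          · exact hmono 1 h
    -- The tableau has no ties; this turns the one-way implication `key` into an equivalence.
    have hinj : ∀ i i' j j', stackedTableau m i j = stackedTableau m i' j' → G i j = G i' j' := by
      intro i i' j j' h
      suffices i = i' ∧ j = j' by rw [this.1, this.2]
      induction i using Fin.lastCases with
      | last =>
        induction i' using Fin.lastCases with
        | last =>
          rw [stackedTableau_last, stackedTableau_last] at h
          exact ⟨rfl, Fin.ext (by omega)⟩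
        | cast i' =>
          rw [stackedTableau_last, stackedTableau_castSucc] at h
          have := i'.2
          fin_cases j <;> fin_cases j' <;> simp at h <;> omega
      | cast i =>
        have := i.2
        induction i' using Fin.lastCases with
        | last =>
          rw [stackedTableau_last, stackedTableau_castSucc] at h
          fin_cases j <;> fin_cases j' <;> simp at h <;> omega
        | cast i' =>
          rw [stackedTableau_castSucc, stackedTableau_castSucc] at h
          have := i'.2
          rw [Fin.castSucc_inj, Fin.ext_iff]
          fin_cases j <;> fin_cases j' <;> simp at h ⊢ <;> omega
    intro i i' j j'
    refine ⟨fun h => ?_, key i i' j j'⟩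
    by_contra! hle
    rcases hle.lt_or_eq with hlt | heq
    · exact (key _ _ _ _ hlt).not_gt h
    · exact h.ne (hinj _ _ _ _ heq.symm)

lemma matchAt_stackedTableau_iff {m n : ℕ} (hm : red (stackedTableau m) = stackedTableau m)
    {F : Filling (m + 1) (n + 1)} (hF : ∀ j, StrictMono fun i => F i j) (s : Fin n) :
    MatchAt (stackedTableau m) F s ↔ StackedAt F s := by
  have hs : (s : ℕ) + 2 ≤ n + 1 := by have := s.2; omega
  have h1 : MatchAt (stackedTableau m) F s ↔ red (window F s 2 hs) = stackedTableau m :=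
    ⟨fun ⟨_, h⟩ => h, fun h => ⟨hs, h⟩⟩
  rw [h1, red_eq_stackedTableau_iff hm (G := window F s 2 hs) fun j => hF _]
  rfl

/-! ### Fully matching fillings as shuffles -/

lemma pmch_add_one_eq_iff {k n : ℕ} (P : Filling k 2) (F : Filling k (n + 1)) :
    pmch P F + 1 = n + 1 ↔ ∀ s : Fin n, MatchAt P F s := by
  have hsub : {s : ℕ | MatchAt P F s} ⊆ Set.Iio n := fun s ⟨h, _⟩ => by
    rw [Set.mem_Iio]; omega
  have hcard : (Set.Iio n).ncard = n := by
    rw [← Finset.coe_Iio, Set.ncard_coe_finset, Nat.card_Iio]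
  rw [add_left_inj, pmch]
  constructor
  · intro h s
    have := Set.eq_of_subset_of_ncard_le hsub (by rw [h, hcard]) (Set.finite_Iio n)
    exact this.symm.subset (show (s : ℕ) ∈ Set.Iio n from s.2)
  · intro h
    rw [Set.Subset.antisymm hsub fun s hs => h ⟨s, hs⟩, hcard]

/-- The lower `m` rows of a filling, read column by column. -/
def lowerWord {m n : ℕ} (F : Filling (m + 1) n) : Fin (n * m) → ℕ :=
  fun p => F (finProdFinEquiv.symm p).2.castSucc (finProdFinEquiv.symm p).1

/-- The cells of the rectangle, split into the top row and the lower rows. -/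
def splitCells (m n : ℕ) : Fin n ⊕ Fin (n * m) → Fin (m + 1) × Fin n :=
  Sum.elim (fun j => (Fin.last m, j))
    fun p => ((finProdFinEquiv.symm p).2.castSucc, (finProdFinEquiv.symm p).1)

lemma splitCells_bijective (m n : ℕ) : Function.Bijective (splitCells m n) := by
  constructor
  · refine Function.Injective.sumElim ?_ ?_ ?_
    · intro j j' h
      exact (Prod.ext_iff.1 h).2
    · intro p p' h
      obtain ⟨h1, h2⟩ := Prod.ext_iff.1 h
      exact finProdFinEquiv.symm.injective (Prod.ext h2 (Fin.castSucc_injective _ h1))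
    · intro j p h
      exact (Fin.castSucc_lt_last _).ne' (Prod.ext_iff.1 h).1
  · rintro ⟨i, j⟩
    induction i using Fin.lastCases with
    | last => exact ⟨Sum.inl j, rfl⟩
    | cast i => exact ⟨Sum.inr (finProdFinEquiv (j, i)), by
      rw [splitCells, Sum.elim_inr, Equiv.symm_apply_apply]⟩

lemma bijOn_sumElim_iff {m n : ℕ} (F : Filling (m + 1) n) (t : Set ℕ) :
    Set.BijOn (Sum.elim (F (Fin.last m)) (lowerWord F)) Set.univ t ↔
      Set.BijOn (fun c : Fin (m + 1) × Fin n => F c.1 c.2) Set.univ t := by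
  have h : Sum.elim (F (Fin.last m)) (lowerWord F) =
      (fun c : Fin (m + 1) × Fin n => F c.1 c.2) ∘ splitCells m n := by
    funext s; cases s <;> rfl
  have hb := splitCells_bijective m n
  rw [h, Set.BijOn, Set.BijOn, Set.mapsTo_univ_iff, Set.mapsTo_univ_iff, Set.injOn_univ,
    Set.injOn_univ, Function.Injective.of_comp_iff' _ hb, Set.SurjOn, Set.SurjOn, Set.image_comp,
    Set.image_univ, hb.surjective.range_eq]
  exact and_congr_left' (hb.surjective.forall
    (p := fun c : Fin (m + 1) × Fin n => F c.1 c.2 ∈ t)).symm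

lemma lowerWord_apply {m n : ℕ} (F : Filling (m + 1) n) (i : Fin m) (j : Fin n) :
    lowerWord F (finProdFinEquiv (j, i)) = F i.castSucc j := by
  simp [lowerWord]

lemma forall_finProdFinEquiv {m n : ℕ} {p : Fin (n * m) → Prop} :
    (∀ x, p x) ↔ ∀ (i : Fin m) (j : Fin n), p (finProdFinEquiv (j, i)) := by
  rw [← finProdFinEquiv.forall_congr_right, Prod.forall, forall_comm]

/-- Column-by-column reading turns relations between adjacent columns into comparisons of word
positions: the first m(j + 2) letters are the lower entries of columns 0 to j + 1. -/
lemma stackedAt_iff_isShuffle {m n : ℕ} (F : Filling (m + 1) (n + 1)) :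
    (IsColumnStrict F ∧ ∀ s : Fin n, StackedAt F s) ↔
      IsShuffle m n (F (Fin.last m)) (lowerWord F) := by
  constructor
  · rintro ⟨⟨hb, hcol⟩, hs⟩
    have htop : StrictMono (F (Fin.last m)) := Fin.strictMono_iff_lt_succ.2 fun s => (hs s).1
    have hrow : ∀ i : Fin m, StrictMono (F i.castSucc) := fun i =>
      Fin.strictMono_iff_lt_succ.2 fun s => (hs s).2.1 i i
    have hlt : ∀ (i i' : Fin m) (j j' : Fin (n + 1)), j < j' →
        F i.castSucc j < F i'.castSucc j' := by
      intro i i' j j' hj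
      induction j' using Fin.cases with
      | zero => exact absurd hj (Fin.not_lt_zero _)
      | succ s =>
        exact ((hrow i).monotone (Fin.le_castSucc_iff.2 hj)).trans_lt ((hs s).2.1 i i')
    refine ⟨(bijOn_sumElim_iff F _).2 hb, htop, ?_, ?_⟩
    · rw [StrictMono, forall_finProdFinEquiv]
      intro i j
      rw [forall_finProdFinEquiv]
      intro i' j' h
      rw [lowerWord_apply, lowerWord_apply]
      rw [Fin.lt_def, finProdFinEquiv_apply_val, finProdFinEquiv_apply_val] at h
      simp only at h
      rcases lt_trichotomy j j' with hj | rfl | hj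
      · exact hlt i i' j j' hj
      · exact hcol j (show i.castSucc < i'.castSucc from by
          rw [Fin.castSucc_lt_castSucc_iff, Fin.lt_def]; omega)
      · have h1 : m * ((j' : ℕ) + 1) ≤ m * j := Nat.mul_le_mul_left _ hj
        rw [mul_add] at h1
        have := i'.2
        omega
    · intro j
      rw [forall_finProdFinEquiv]
      intro i j' h
      rw [lowerWord_apply]
      rw [finProdFinEquiv_apply_val] at h
      simp only at h
      have hj : (j' : ℕ) < j + 2 := by
        by_contra! hge
        have := Nat.mul_le_mul_left m hge
        omega
      rcases Nat.lt_or_ge j j' with hj' | hj'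
      · induction j' using Fin.cases with
        | zero => simp at hj'
        | succ s =>
          -- The only column beyond j still in reach is j + 1, covered by the third relation of
          -- `StackedAt`.
          obtain rfl : j = s.castSucc := Fin.ext (by simp at *; omega)
          exact (hs s).2.2 i
      · exact ((hrow i).monotone hj').trans_lt (hcol j (Fin.castSucc_lt_last i))
  · intro h
    have hlow : ∀ (i i' : Fin m) (j j' : Fin (n + 1)), m * (j : ℕ) + i < m * j' + i' →
        F i.castSucc j < F i'.castSucc j' := by
      intro i i' j j' hlt
      rw [← lowerWord_apply F, ← lowerWord_apply F]
      refine h.right ?_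
      rw [Fin.lt_def, finProdFinEquiv_apply_val, finProdFinEquiv_apply_val]
      simp only
      omega
    have hup : ∀ (i : Fin m) (j j' : Fin (n + 1)), (j' : ℕ) ≤ j + 1 →
        F i.castSucc j' < F (Fin.last m) j := by
      intro i j j' hj
      rw [← lowerWord_apply F]
      refine h.lt _ _ ?_
      rw [finProdFinEquiv_apply_val]
      simp only
      have := Nat.mul_le_mul_left m hj
      have := i.2
      rw [show m * ((j : ℕ) + 2) = m * (j + 1) + m by ring]
      omega
    refine ⟨⟨(bijOn_sumElim_iff F _).1 h.bijOn, fun j i i' hi => ?_⟩, fun s => ⟨?_, ?_, ?_⟩⟩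
    · induction i' using Fin.lastCases with
      | last =>
        induction i using Fin.lastCases with
        | last => exact absurd hi (lt_irrefl _)
        | cast i => exact hup i j j (Nat.le_succ _)
      | cast i' =>
        induction i using Fin.lastCases with
        | last => exact absurd hi (Fin.castSucc_lt_last _).not_gt
        | cast i => exact hlow i i' j j (Nat.add_lt_add_left hi _)
    · exact h.left (Fin.castSucc_lt_succ)
    · intro i i'
      refine hlow i i' _ _ ?_
      rw [Fin.val_castSucc, Fin.val_succ, mul_add]
      have := i.2
      omega
    · intro i
      exact hup i _ _ (by simp)

lemma exists_filling {m n : ℕ} (c : Fin n → ℕ) (d : Fin (n * m) → ℕ) :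
    ∃ F : Filling (m + 1) n, F (Fin.last m) = c ∧ lowerWord F = d :=
  ⟨Fin.snoc (α := fun _ => Fin n → ℕ) (fun i j => d (finProdFinEquiv (j, i))) c, by simp, by
    funext p; simp only [lowerWord, Fin.snoc_castSucc, Prod.mk.eta, Equiv.apply_symm_apply]⟩

lemma filling_ext {m n : ℕ} {F F' : Filling (m + 1) n} (h : F (Fin.last m) = F' (Fin.last m))
    (h' : lowerWord F = lowerWord F') : F = F' := by
  funext i j
  induction i using Fin.lastCases with
  | last => rw [h]
  | cast i => rw [← lowerWord_apply F, h', lowerWord_apply]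

lemma mem_full_stackedTableau_iff {m n : ℕ} (hm : red (stackedTableau m) = stackedTableau m)
    {F : Filling (m + 1) (n + 1)} :
    F ∈ Full (stackedTableau m) (n + 1) ↔ IsShuffle m n (F (Fin.last m)) (lowerWord F) := by
  rw [← stackedAt_iff_isShuffle, Full, Set.mem_ofPred_eq, pmch_add_one_eq_iff]
  exact and_congr_right fun h => forall_congr' fun s => matchAt_stackedTableau_iff hm h.2 s

/-- Recording the top entries other than the last is a bijection onto ballot sets: the last top
entry is forced, and the complement in increasing order gives the lower word. -/
theorem full_stackedTableau {m : ℕ} (hm : red (stackedTableau m) = stackedTableau m) (n : ℕ) :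
    full (stackedTableau m) (n + 1) = (ballotSets m ((m + 1) * (n + 1)) n).card := by
  rw [full, ← Set.ncard_coe_finset]
  refine Set.BijOn.ncard_eq (f := fun F : Filling (m + 1) (n + 1) =>
    univ.image fun j : Fin n => F (Fin.last m) j.castSucc) ⟨?_, ?_, ?_⟩
  · intro F hF
    exact ((mem_full_stackedTableau_iff hm).1 hF).image_mem_ballotSets
  · intro F hF F' hF' h
    have := ((mem_full_stackedTableau_iff hm).1 hF).ext ((mem_full_stackedTableau_iff hm).1 hF') h
    exact filling_ext this.1 this.2
  · intro T hT
    obtain ⟨c, d, h, rfl⟩ := exists_isShuffle hT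
    obtain ⟨F, rfl, rfl⟩ := exists_filling c d
    exact ⟨F, (mem_full_stackedTableau_iff hm).2 h, rfl⟩

/-! ### The two patterns of the theorem -/

lemma stackedTableau_one : stackedTableau 1 = tableau22 := by decide

lemma stackedTableau_two : stackedTableau 2 = tableau222 := by decide

lemma red_tableau22 : red tableau22 = tableau22 := by decide

lemma red_tableau222 : red tableau222 = tableau222 := by decide

end RectFilling

theorem mainTheorem9 :
    (∀ n : ℕ, (RectFilling.full RectFilling.tableau22 (n + 1) : ℚ) =
      1 / ((n : ℚ) + 1) * (Nat.choose (2 * n) n : ℚ)) ∧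
    (∀ n : ℕ, (RectFilling.full RectFilling.tableau222 (n + 1) : ℚ) =
      1 / (2 * (n : ℚ) + 1) * (Nat.choose (3 * n) n : ℚ)) := by
  open RectFilling in
  constructor
  · intro n
    have h := full_stackedTableau (m := 1) (by rw [stackedTableau_one, red_tableau22]) n
    rw [← stackedTableau_one, h, card_ballotSets]
    norm_num
  · intro n
    have h := full_stackedTableau (m := 2) (by rw [stackedTableau_two, red_tableau222]) n
    rw [← stackedTableau_two, h, card_ballotSets]
    norm_num
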